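/- Let $d\ge 1$, let $B=\{x\in\mathbb{R}^d:|x-x_0|\le r_0\}$ be a closed Euclidean ball with $x_0\in\mathbb{R}^d$ and $0<r_0<\infty$, and let $f:\mathbb{R}^d\to\mathbb{C}$ be a Lebesgue measurable function that vanishes outside $B$. For $x\in\mathbb{R}^d$ let $$M(f)(x)=\sup_{r>0}\frac{1}{|B(x,r)|}\int_{B(x,r)}|f(y)|\,dy\in[0,\infty]$$ be the centred Hardy–Littlewood maximal function of $f$, where $B(x,r)$ is the open ball with centre $x$ and radius $r$ and $|\cdot|$ of a set is its Lebesgue measure. Let $$\Psi(x,t)=\frac{t}{\log(e+t)+\log(e+|x|)},\qquad x\in\mathbb{R}^d,\ t\in[0,\infty).$$ Say that a measurable function $g:\mathbb{R}^d\to[0,\infty]$ lies in $L_\Psi(B)$ if $g<\infty$ almost everywhere on $B$ and $\int_B\Psi(x,g(x))\,dx<\infty$. Say that $f$ lies in $L\log\log L(B)$ if $f$ is locally integrable on $\mathbb{R}^d$, vanishes outside $B$, and $\int_B|f(x)|\,\log^+\log^+|f(x)|\,dx<\infty$, where $\log^+s=\max\{\log s,0\}$ for $s>0$ and $\log^+0=0$.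 Then $M(f)\in L_\Psi(B)$ if and only if $f\in L\log\log L(B)$. -/

import Mathlib

open MeasureTheory Set Metric
open scoped ENNReal

noncomputable section

/-- The centred Hardy–Littlewood maximal function
`M f (x) = sup_{r > 0} |B(x,r)|⁻¹ ∫_{B(x,r)} |f|` on `ℝ^d`, over open Euclidean balls, with values
in `[0,∞]`. -/
def hlMaximal {d : ℕ} (f : EuclideanSpace ℝ (Fin d) → ℂ) (x : EuclideanSpace ℝ (Fin d)) : ℝ≥0∞ :=
  ⨆ (r : ℝ) (_ : 0 < r), (∫⁻ y in ball x r, ‖f y‖ₑ) / volume (ball x r)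

/-- `Ψ(x,t) = t / (log (e + t) + log (e + |x|))`, used for `t ≥ 0` only. -/
def Psi {d : ℕ} (x : EuclideanSpace ℝ (Fin d)) (t : ℝ) : ℝ :=
  t / (Real.log (Real.exp 1 + t) + Real.log (Real.exp 1 + ‖x‖))

/-- Membership of a nonnegative function `g` in `L_Ψ(B)`: `g` is measurable and finite
almost everywhere on `B`, and `∫_B Ψ(x, g(x)) dx < ∞`. -/
def MemLPsi {d : ℕ} (B : Set (EuclideanSpace ℝ (Fin d)))
    (g : EuclideanSpace ℝ (Fin d) → ℝ≥0∞) : Prop :=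
  AEMeasurable g (volume.restrict B) ∧
  (∀ᵐ x ∂(volume.restrict B), g x < ∞) ∧
  ∫⁻ x in B, ENNReal.ofReal (Psi x (g x).toReal) < ∞

/-- Membership in `L log log L (B)`: `f` is locally integrable on `ℝ^d`, supported in `B`, and
`∫_B |f| log⁺ log⁺ |f| < ∞`. -/
def MemLLogLogL {d : ℕ} (B : Set (EuclideanSpace ℝ (Fin d)))
    (f : EuclideanSpace ℝ (Fin d) → ℂ) : Prop :=
  LocallyIntegrable f volume ∧
  Function.support f ⊆ B ∧
  ∫⁻ x in B, ENNReal.ofReal (‖f x‖ * Real.posLog (Real.posLog ‖f x‖)) < ∞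

end

/-! On the bounded ball `B` the term `log (e + |x|)` is bounded, so `Ψ(x, t)` is comparable to `t /
log (e + t)`, whose derivative is comparable to `1 / log (e + t)`. Hence `∫_B Ψ(x, Mf)` is finite
exactly when the integral of `|B ∩ {Mf > t}| / log (e + t)` over `t > 0` is.

The distribution function of `Mf` is controlled from both sides by the mass of `f` at large heights:
`t |{Mf > t}| ≲ ∫_{2|f| > t} |f|` (`mul_volume_lt_hlMaximal_le`) and, for large `t`, `∫_{|f| > t}
|f| ≲ t |B ∩ {3^d Mf > t}|` (`absMeasure_lt_norm_le`). Both come from Vitali coverings. Substituting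
them leaves the integral of `1 / ((e + t) log (e + t))` against `∫_{|f| > t} |f|`. Since that weight
is the derivative of `log log (e + t)`, the layer cake formula for the measure `|f| dx` turns it
into `∫ |f| log log (e + |f|)`.

Small `t` costs only a constant, because `|B|` and `‖f‖₁` are finite. If `Mf` is finite a.e. on `B`,
integrability of `f` follows (`absMeasure_univ_ne_top`). -/

noncomputable section

open Filter Topology Module

/-! ### Volumes of balls and measurability of the maximal function. -/

variable {d : ℕ}

/-- The measure `|f| dx`. -/
def absMeasure (f : EuclideanSpace ℝ (Fin d) → ℂ) : Measure (EuclideanSpace ℝ (Fin d)) :=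
  volume.withDensity fun y => ‖f y‖ₑ

theorem absMeasure_apply (f : EuclideanSpace ℝ (Fin d) → ℂ) (s : Set (EuclideanSpace ℝ (Fin d))) :
    absMeasure f s = ∫⁻ y in s, ‖f y‖ₑ :=
  withDensity_apply' _ s

theorem volume_closedBall_eq (x : EuclideanSpace ℝ (Fin d)) {r : ℝ} (hr : 0 ≤ r) :
    volume (closedBall x r) =
      ENNReal.ofReal r ^ d * volume (ball (0 : EuclideanSpace ℝ (Fin d)) 1) := by
  rw [Measure.addHaar_closedBall _ _ hr, finrank_euclideanSpace_fin, ENNReal.ofReal_pow hr]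

theorem volume_ball_eq_closedBall (x : EuclideanSpace ℝ (Fin d)) {r : ℝ} (hr : 0 < r) :
    volume (ball x r) = volume (closedBall x r) := by
  rw [Measure.addHaar_closedBall _ _ hr.le, Measure.addHaar_ball_of_pos _ _ hr]

theorem volume_closedBall_mul (x y : EuclideanSpace ℝ (Fin d)) {c r : ℝ} (hc : 0 ≤ c)
    (hr : 0 ≤ r) :
    volume (closedBall x (c * r)) = ENNReal.ofReal c ^ d * volume (closedBall y r) := by
  rw [volume_closedBall_eq _ (mul_nonneg hc hr), volume_closedBall_eq _ hr,
    ENNReal.ofReal_mul hc, mul_pow, mul_assoc]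

theorem hlMaximal_eq_iSup (f : EuclideanSpace ℝ (Fin d) → ℂ) (x : EuclideanSpace ℝ (Fin d)) :
    hlMaximal f x = ⨆ (r : ℝ) (_ : 0 < r), absMeasure f (ball x r) / volume (ball x r) := by
  simp only [absMeasure_apply, hlMaximal]

theorem lt_hlMaximal_iff {f : EuclideanSpace ℝ (Fin d) → ℂ} {x : EuclideanSpace ℝ (Fin d)}
    {a : ℝ≥0∞} :
    a < hlMaximal f x ↔ ∃ r : ℝ, 0 < r ∧ a * volume (ball x r) < absMeasure f (ball x r) := by
  simp only [hlMaximal_eq_iSup, lt_iSup_iff, exists_prop]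
  refine exists_congr fun r => and_congr_right fun hr => ?_
  rw [ENNReal.lt_div_iff_mul_lt (Or.inl (measure_ball_pos _ _ hr).ne')
    (Or.inl measure_ball_lt_top.ne)]

/-- An open ball is the increasing union of concentric smaller balls, so one of these already has
mass above `a`; it stays inside `ball z r` for every `z` near `x`. -/
theorem lowerSemicontinuous_measure_ball {α : Type*} [PseudoMetricSpace α] [MeasurableSpace α]
    (μ : Measure α) (r : ℝ) : LowerSemicontinuous fun x => μ (ball x r) := by
  intro x a ha
  have hU : ball x r = ⋃ n : ℕ, ball x (r - 1 / ((n : ℝ) + 1)) := by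
    ext y
    simp only [mem_ball, mem_iUnion]
    constructor
    · intro h
      obtain ⟨n, hn⟩ := exists_nat_one_div_lt (sub_pos.2 h)
      exact ⟨n, by linarith⟩
    · rintro ⟨n, hn⟩
      have : (0 : ℝ) < 1 / ((n : ℝ) + 1) := by positivity
      linarith
  have hmono : Monotone fun n : ℕ => ball x (r - 1 / ((n : ℝ) + 1)) := by
    intro m n hmn
    apply ball_subset_ball
    have : 1 / ((n : ℝ) + 1) ≤ 1 / ((m : ℝ) + 1) := by gcongr
    linarith
  change a < μ (ball x r) at ha
  rw [hU, hmono.measure_iUnion, lt_iSup_iff] at ha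
  obtain ⟨n, hn⟩ := ha
  have hpos : (0 : ℝ) < 1 / ((n : ℝ) + 1) := by positivity
  filter_upwards [ball_mem_nhds x hpos] with z hz
  refine hn.trans_le (measure_mono (ball_subset_ball' ?_))
  rw [mem_ball, dist_comm] at hz
  linarith

theorem measurable_hlMaximal (f : EuclideanSpace ℝ (Fin d) → ℂ) : Measurable (hlMaximal f) := by
  refine LowerSemicontinuous.measurable fun x a ha => ?_
  obtain ⟨r, hr, h⟩ := lt_hlMaximal_iff.1 ha
  filter_upwards [lowerSemicontinuous_measure_ball (absMeasure f) r x _ h] with z hz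
  refine lt_hlMaximal_iff.2 ⟨r, hr, ?_⟩
  rwa [Measure.addHaar_ball_center volume x, ← Measure.addHaar_ball_center volume z] at hz

/-! ### Coverings and the weak type inequality. -/

/-- The Vitali covering lemma for a set of centres. -/
theorem exists_countable_disjoint_closedBall_covering {α : Type*} [MetricSpace α]
    [TopologicalSpace.SeparableSpace α] (S : Set α) (r : α → ℝ) (R : ℝ)
    (hpos : ∀ x ∈ S, 0 < r x) (hR : ∀ x ∈ S, r x ≤ R) :
    ∃ u ⊆ S, u.Countable ∧ (u.PairwiseDisjoint fun x => closedBall x (r x)) ∧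
      S ⊆ ⋃ x ∈ u, closedBall x (5 * r x) := by
  obtain ⟨u, huS, hdisj, hcov⟩ :=
    Vitali.exists_disjoint_subfamily_covering_enlargement_closedBall S id r R hR 5 (by norm_num)
  refine ⟨u, huS, hdisj.countable_of_nonempty_interior fun x hx => ?_, hdisj, fun x hx => ?_⟩
  · exact ⟨x, ball_subset_interior_closedBall (mem_ball_self (hpos x (huS hx)))⟩
  · obtain ⟨b, hb, hsub⟩ := hcov x hx
    exact mem_biUnion hb (hsub (mem_closedBall_self (hpos x hx).le))

theorem tsum_measure_closedBall_le {α : Type*} [PseudoMetricSpace α] [MeasurableSpace α]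
    [OpensMeasurableSpace α] (μ : Measure α) {u : Set α} {r : α → ℝ} (hu : u.Countable)
    (hdisj : u.PairwiseDisjoint fun x => closedBall x (r x)) (T : Set α) :
    ∑' x : u, μ (T ∩ closedBall x (r x)) ≤ μ T := by
  have h : ∀ x : u, μ (T ∩ closedBall (x : α) (r x)) = μ.restrict T (closedBall (x : α) (r x)) :=
    fun x => by rw [Measure.restrict_apply measurableSet_closedBall, inter_comm]
  simp only [h]
  rw [← measure_biUnion hu hdisj fun x _ => measurableSet_closedBall]
  exact (measure_mono (subset_univ _)).trans (by rw [Measure.restrict_apply_univ])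

/-- Vitali's lemma needs bounded radii. Volumes grow with the radius only when `d ≥ 1`. -/
theorem exists_radius_bound (hd : 1 ≤ d) {a b : ℝ≥0∞} (ha0 : a ≠ 0) (ha : a ≠ ∞) (hb : b ≠ ∞) :
    ∃ R : ℝ, ∀ (x : EuclideanSpace ℝ (Fin d)) (r : ℝ), 0 < r →
      a * volume (closedBall x r) ≤ b → r ≤ R := by
  have hω0 : volume (ball (0 : EuclideanSpace ℝ (Fin d)) 1) ≠ 0 :=
    (measure_ball_pos _ _ one_pos).ne'
  have hω : volume (ball (0 : EuclideanSpace ℝ (Fin d)) 1) ≠ ∞ := measure_ball_lt_top.ne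
  set ω := volume (ball (0 : EuclideanSpace ℝ (Fin d)) 1)
  refine ⟨max 1 (b / (a * ω)).toReal, fun x r hr h => ?_⟩
  rw [volume_closedBall_eq x hr.le] at h
  have h1 : ENNReal.ofReal r ^ d ≤ b / (a * ω) := by
    rw [ENNReal.le_div_iff_mul_le (Or.inl (mul_ne_zero ha0 hω0))
      (Or.inl (ENNReal.mul_ne_top ha hω))]
    calc _ = a * (ENNReal.ofReal r ^ d * ω) := by ring
      _ ≤ b := h
  have h2 : r ^ d ≤ (b / (a * ω)).toReal := by
    rw [← ENNReal.ofReal_pow hr.le] at h1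
    exact (ENNReal.ofReal_le_iff_le_toReal
      (ENNReal.div_ne_top hb (mul_ne_zero ha0 hω0))).1 h1
  rcases le_total r 1 with h3 | h3
  · exact h3.trans (le_max_left _ _)
  · exact ((le_self_pow₀ h3 (by omega)).trans h2).trans (le_max_right _ _)

/-- The weak type `(1,1)` inequality for the truncation of `f` at height `t / 2`. -/
theorem mul_volume_lt_hlMaximal_le (hd : 1 ≤ d) {f : EuclideanSpace ℝ (Fin d) → ℂ}
    (hf : AEMeasurable f volume) (hfin : absMeasure f univ ≠ ∞) {t : ℝ} (ht : 0 < t) :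
    ENNReal.ofReal t * volume {x | ENNReal.ofReal t < hlMaximal f x} ≤
      2 * 5 ^ d * absMeasure f {y | t < 2 * ‖f y‖} := by
  set T := {y | t < 2 * ‖f y‖} with hT
  have hTm : NullMeasurableSet T := nullMeasurableSet_lt aemeasurable_const (hf.norm.const_mul 2)
  set S := {x | ENNReal.ofReal t < hlMaximal f x} with hS
  have ht0 : ENNReal.ofReal t ≠ 0 := (ENNReal.ofReal_pos.2 ht).ne'
  have hr : ∀ x ∈ S, ∃ r : ℝ, 0 < r ∧
      ENNReal.ofReal t * volume (closedBall x r) ≤ absMeasure f (closedBall x r) := by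
    intro x hx
    obtain ⟨r, hr, h⟩ := lt_hlMaximal_iff.1 hx
    rw [volume_ball_eq_closedBall _ hr] at h
    exact ⟨r, hr, h.le.trans (measure_mono ball_subset_closedBall)⟩
  choose! r hr0 hr using hr
  obtain ⟨R, hR⟩ := exists_radius_bound hd ht0 ENNReal.ofReal_ne_top hfin
  obtain ⟨u, huS, huc, hdisj, hcov⟩ := exists_countable_disjoint_closedBall_covering S r R hr0
    fun x hx => hR x _ (hr0 x hx) ((hr x hx).trans (measure_mono (subset_univ _)))
  have hhalf : ENNReal.ofReal t = 2 * ENNReal.ofReal (t / 2) := by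
    rw [← ENNReal.ofReal_ofNat, ← ENNReal.ofReal_mul (by norm_num)]
    congr 1
    ring
  have hball : ∀ x ∈ S, ENNReal.ofReal t * volume (closedBall x (r x)) ≤
      2 * absMeasure f (T ∩ closedBall x (r x)) := by
    intro x hx
    -- Off `T` one has `|f| ≤ t / 2`, which accounts for at most half of `t |ball|`; the other half
    -- must come from `T`.
    have h1 : absMeasure f (closedBall x (r x) \ T) ≤
        ENNReal.ofReal (t / 2) * volume (closedBall x (r x)) := by
      rw [absMeasure_apply]
      calc ∫⁻ y in closedBall x (r x) \ T, ‖f y‖ₑ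
          ≤ ∫⁻ y in closedBall x (r x) \ T, ENNReal.ofReal (t / 2) := by
            refine lintegral_mono_ae ((ae_restrict_iff'₀
              (measurableSet_closedBall.nullMeasurableSet.diff hTm)).2 (ae_of_all _ fun y hy => ?_))
            have h5 : ¬ t < 2 * ‖f y‖ := hy.2
            rw [← ofReal_norm]
            exact ENNReal.ofReal_le_ofReal (by linarith)
        _ ≤ _ := by
            rw [setLIntegral_const]
            gcongr
            exact sdiff_subset
    have h2 : absMeasure f (closedBall x (r x)) ≤
        absMeasure f (T ∩ closedBall x (r x)) + absMeasure f (closedBall x (r x) \ T) := by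
      rw [inter_comm]
      exact measure_le_inter_add_sdiff _ _ _
    have h3 : ENNReal.ofReal (t / 2) * volume (closedBall x (r x)) ≠ ∞ :=
      ENNReal.mul_ne_top ENNReal.ofReal_ne_top measure_closedBall_lt_top.ne
    have h4 := (hr x hx).trans (h2.trans (add_le_add le_rfl h1))
    rw [hhalf, mul_assoc, two_mul] at h4
    rw [hhalf, mul_assoc]
    gcongr
    exact ENNReal.le_of_add_le_add_right h3 h4
  calc ENNReal.ofReal t * volume S
      ≤ ENNReal.ofReal t * ∑' x : u, volume (closedBall (x : EuclideanSpace ℝ (Fin d)) (5 * r x)) := by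
        gcongr
        exact (measure_mono hcov).trans (measure_biUnion_le volume huc _)
    _ = ∑' x : u, 5 ^ d * (ENNReal.ofReal t *
          volume (closedBall (x : EuclideanSpace ℝ (Fin d)) (r x))) := by
        rw [← ENNReal.tsum_mul_left]
        congr 1
        ext x
        rw [volume_closedBall_mul _ (x : EuclideanSpace ℝ (Fin d)) (by norm_num)
          (hr0 x (huS x.2)).le, ENNReal.ofReal_ofNat]
        ring
    _ ≤ ∑' x : u, 5 ^ d * (2 * absMeasure f (T ∩ closedBall (x : EuclideanSpace ℝ (Fin d)) (r x))) :=
        ENNReal.tsum_le_tsum fun x => mul_le_mul_right (hball x (huS x.2)) _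
    _ = 2 * 5 ^ d * ∑' x : u, absMeasure f (T ∩ closedBall (x : EuclideanSpace ℝ (Fin d)) (r x)) := by
        rw [ENNReal.tsum_mul_left, ENNReal.tsum_mul_left]
        ring
    _ ≤ 2 * 5 ^ d * absMeasure f T := by
        gcongr
        exact tsum_measure_closedBall_le _ huc hdisj T

/-! ### The reverse weak type inequality. -/

/-- Moving the centre from `y` towards `x₀` by at most `r / 4` gives a ball of radius `r / 4` inside
both balls. -/
theorem volume_closedBall_le_inter {x₀ y : EuclideanSpace ℝ (Fin d)} {r r₀ : ℝ} (hr : 0 < r)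
    (hr₀ : 0 < r₀) (hy : y ∈ closedBall x₀ r₀) (hrr : r ≤ 2 * r₀) :
    volume (closedBall y r) ≤ 4 ^ d * volume (closedBall x₀ r₀ ∩ closedBall y r) := by
  set s := r / (4 * r₀) with hs
  have hs0 : 0 < s := by positivity
  have hs1 : s ≤ 1 := by rw [hs, div_le_one (by positivity)]; linarith
  have hsr : s * r₀ = r / 4 := by rw [hs]; field_simp
  set z := AffineMap.lineMap y x₀ s with hz
  have hyd : dist y x₀ ≤ r₀ := hy
  have h1 : dist z y ≤ r / 4 := by
    rw [hz, dist_lineMap_left, Real.norm_eq_abs, abs_of_pos hs0, ← hsr]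
    gcongr
  have h2 : dist z x₀ ≤ (1 - s) * r₀ := by
    rw [hz, dist_lineMap_right, Real.norm_eq_abs, abs_of_nonneg (by linarith)]
    gcongr
  have h3 : closedBall z (r / 4) ⊆ closedBall x₀ r₀ ∩ closedBall y r :=
    subset_inter (closedBall_subset_closedBall' (by linarith))
      (closedBall_subset_closedBall' (by linarith))
  calc volume (closedBall y r) = volume (closedBall y (4 * (r / 4))) := by congr 2; ring
    _ = 4 ^ d * volume (closedBall z (r / 4)) := by
        rw [volume_closedBall_mul _ z (by norm_num) (by positivity), ENNReal.ofReal_ofNat]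
    _ ≤ _ := by gcongr

theorem lt_three_pow_mul_hlMaximal {f : EuclideanSpace ℝ (Fin d) → ℂ} {a : ℝ≥0∞}
    {x y : EuclideanSpace ℝ (Fin d)} {r : ℝ} (hr : 0 < r) (hx : x ∈ closedBall y r)
    (h : a * volume (closedBall y r) < absMeasure f (closedBall y r)) :
    a < 3 ^ d * hlMaximal f x := by
  have hsub : closedBall y r ⊆ ball x (3 * r) := by
    intro z hz
    have h1 := dist_triangle_right z x y
    rw [mem_closedBall] at hx hz
    rw [mem_ball]
    linarith
  have h0 : (3 : ℝ≥0∞) ^ d ≠ 0 := by positivity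
  have h1 : (3 : ℝ≥0∞) ^ d ≠ ∞ := by finiteness
  have h2 : a / 3 ^ d < hlMaximal f x := by
    refine lt_hlMaximal_iff.2 ⟨3 * r, by positivity, ?_⟩
    rw [volume_ball_eq_closedBall _ (by positivity), volume_closedBall_mul _ y (by norm_num) hr.le,
      ENNReal.ofReal_ofNat, ← mul_assoc, ENNReal.div_mul_cancel h0 h1]
    exact h.trans_le (measure_mono hsub)
  rwa [ENNReal.div_lt_iff (Or.inl h0) (Or.inl h1), mul_comm] at h2

/-- Lebesgue differentiation for `|f|`, in the form of balls on which the mean of `|f|` is large. -/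
theorem ae_exists_closedBall_lt_absMeasure {f : EuclideanSpace ℝ (Fin d) → ℂ}
    (hf : AEMeasurable f volume) (hfin : absMeasure f univ ≠ ∞) (t : ℝ≥0∞) :
    ∀ᵐ y, t < ‖f y‖ₑ → ∃ r : ℝ, 0 < r ∧
      t * volume (closedBall y r) < absMeasure f (closedBall y r) := by
  have hfin' : ∫⁻ y, ‖f y‖ₑ ≠ ∞ := by
    rwa [absMeasure_apply, setLIntegral_univ] at hfin
  filter_upwards [(Besicovitch.vitaliFamily (volume :
    Measure (EuclideanSpace ℝ (Fin d)))).ae_tendsto_lintegral_div hf.enorm hfin'] with y hy hty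
  have h1 := (hy.comp (Besicovitch.tendsto_filterAt volume y)).eventually (lt_mem_nhds hty)
  obtain ⟨r, hr, hr0⟩ := (h1.and self_mem_nhdsWithin).exists
  have hr0 : 0 < r := hr0
  refine ⟨r, hr0, ?_⟩
  rw [absMeasure_apply]
  exact (ENNReal.lt_div_iff_mul_lt (Or.inl (measure_closedBall_pos _ _ hr0).ne')
    (Or.inl measure_closedBall_lt_top.ne)).1 hr

/-- The reverse weak type inequality. -/
theorem absMeasure_lt_norm_le {f : EuclideanSpace ℝ (Fin d) → ℂ} (hf : AEMeasurable f volume)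
    {x₀ : EuclideanSpace ℝ (Fin d)} {r₀ : ℝ} (hr₀ : 0 < r₀)
    (hsupp : Function.support f ⊆ closedBall x₀ r₀) (hfin : absMeasure f univ ≠ ∞)
    {t : ℝ} (ht : 0 < t)
    (hlarge : absMeasure f univ ≤
      ENNReal.ofReal t * volume (closedBall (0 : EuclideanSpace ℝ (Fin d)) (2 * r₀))) :
    absMeasure f {y | t < ‖f y‖} ≤ 20 ^ d * (ENNReal.ofReal t *
      volume ({x | ENNReal.ofReal t < 3 ^ d * hlMaximal f x} ∩ closedBall x₀ r₀)) := by
  set G := {x | ENNReal.ofReal t < 3 ^ d * hlMaximal f x} ∩ closedBall x₀ r₀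
  set A : EuclideanSpace ℝ (Fin d) → Set ℝ := fun y =>
    {r | 0 < r ∧ ENNReal.ofReal t * volume (closedBall y r) < absMeasure f (closedBall y r)}
  set S := {y | t < ‖f y‖ ∧ (A y).Nonempty}
  have hS : absMeasure f {y | t < ‖f y‖} ≤ absMeasure f S := by
    refine measure_mono_ae (withDensity_absolutelyContinuous volume _ ?_)
    filter_upwards [ae_exists_closedBall_lt_absMeasure hf hfin (ENNReal.ofReal t)] with y hy hty
    refine ⟨hty, hy ?_⟩
    rw [← ofReal_norm]
    exact (ENNReal.ofReal_lt_ofReal_iff (ht.trans hty)).2 hty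
  -- By `hlarge`, a ball of radius above `2 * r₀` is too big for its mean of `|f|` to exceed `t`.
  have hA : ∀ y, ∀ r ∈ A y, r ≤ 2 * r₀ := by
    intro y r hr
    by_contra! h
    refine hr.2.not_ge (((measure_mono (subset_univ _)).trans hlarge).trans ?_)
    rw [← Measure.addHaar_closedBall_center volume y]
    gcongr
  -- Stopping radius: `r` lies within a factor 5 of the supremum of `A y`, so the mean exceeds `t`
  -- at `r` but not at `5 * r`, the radius of the Vitali enlargement.
  have hr : ∀ y ∈ S, ∃ r, 0 < r ∧ r ∈ A y ∧ 5 * r ∉ A y := by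
    intro y hy
    obtain ⟨ρ, hρ⟩ := hy.2
    have hbdd : BddAbove (A y) := ⟨2 * r₀, fun r hr => hA y r hr⟩
    have hs : 0 < sSup (A y) := hρ.1.trans_le (le_csSup hbdd hρ)
    obtain ⟨r, hrA, hr⟩ := exists_lt_of_lt_csSup hy.2 (show sSup (A y) / 5 < sSup (A y) by linarith)
    refine ⟨r, hrA.1, hrA, fun h => ?_⟩
    have := le_csSup hbdd h
    linarith
  choose! r hr0 hrA hr5 using hr
  obtain ⟨u, huS, huc, hdisj, hcov⟩ := exists_countable_disjoint_closedBall_covering S r (2 * r₀) hr0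
    fun y hy => hA y _ (hrA y hy)
  have hball : ∀ y ∈ S, absMeasure f (closedBall y (5 * r y)) ≤
      20 ^ d * (ENNReal.ofReal t * volume (G ∩ closedBall y (r y))) := by
    intro y hy
    have h1 : absMeasure f (closedBall y (5 * r y)) ≤
        ENNReal.ofReal t * volume (closedBall y (5 * r y)) := by
      by_contra! h
      exact hr5 y hy ⟨by linarith [hr0 y hy], h⟩
    have hyB : y ∈ closedBall x₀ r₀ := hsupp fun h => by
      have := hy.1
      rw [h, norm_zero] at this
      exact this.not_gt ht
    have h2 : closedBall x₀ r₀ ∩ closedBall y (r y) ⊆ G ∩ closedBall y (r y) := fun x hx =>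
      ⟨⟨lt_three_pow_mul_hlMaximal (hr0 y hy) hx.2 (hrA y hy).2, hx.1⟩, hx.2⟩
    calc absMeasure f (closedBall y (5 * r y))
        ≤ ENNReal.ofReal t * (5 ^ d * volume (closedBall y (r y))) := by
          rwa [volume_closedBall_mul _ y (by norm_num) (hr0 y hy).le, ENNReal.ofReal_ofNat] at h1
      _ ≤ ENNReal.ofReal t * (5 ^ d * (4 ^ d * volume (G ∩ closedBall y (r y)))) := by
          gcongr
          exact (volume_closedBall_le_inter (hr0 y hy) hr₀ hyB (hA y _ (hrA y hy))).trans
            (by gcongr)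
      _ = (5 * 4) ^ d * (ENNReal.ofReal t * volume (G ∩ closedBall y (r y))) := by
          rw [mul_pow]; ring
      _ = _ := by norm_num
  calc absMeasure f {y | t < ‖f y‖} ≤ absMeasure f S := hS
    _ ≤ ∑' y : u, absMeasure f (closedBall (y : EuclideanSpace ℝ (Fin d)) (5 * r y)) :=
        (measure_mono hcov).trans (measure_biUnion_le _ huc _)
    _ ≤ ∑' y : u, 20 ^ d * (ENNReal.ofReal t *
          volume (G ∩ closedBall (y : EuclideanSpace ℝ (Fin d)) (r y))) :=
        ENNReal.tsum_le_tsum fun y => hball y (huS y.2)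
    _ = 20 ^ d * (ENNReal.ofReal t *
          ∑' y : u, volume (G ∩ closedBall (y : EuclideanSpace ℝ (Fin d)) (r y))) := by
        rw [ENNReal.tsum_mul_left, ENNReal.tsum_mul_left]
    _ ≤ 20 ^ d * (ENNReal.ofReal t * volume G) := by
        gcongr
        exact tsum_measure_closedBall_le _ huc hdisj G

/-! ### Calculus of the weights and the layer cake formula. -/

theorem one_le_log_exp_one_add {t : ℝ} (ht : 0 ≤ t) : 1 ≤ Real.log (Real.exp 1 + t) := by
  rw [Real.le_log_iff_exp_le (by positivity)]
  linarith

/-- The derivative of `t / log (e + t)`. -/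
def divLogDeriv (t : ℝ) : ℝ :=
  1 / Real.log (Real.exp 1 + t) - t / ((Real.exp 1 + t) * Real.log (Real.exp 1 + t) ^ 2)

theorem hasDerivAt_log_exp_one_add {t : ℝ} (ht : 0 ≤ t) :
    HasDerivAt (fun t => Real.log (Real.exp 1 + t)) (1 / (Real.exp 1 + t)) t :=
  ((hasDerivAt_id t).const_add (Real.exp 1)).log (by positivity)

theorem hasDerivAt_log_log {t : ℝ} (ht : 0 ≤ t) :
    HasDerivAt (fun t => Real.log (Real.log (Real.exp 1 + t)))
      (1 / ((Real.exp 1 + t) * Real.log (Real.exp 1 + t))) t := by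
  have h := one_le_log_exp_one_add ht
  convert (hasDerivAt_log_exp_one_add ht).log (by positivity) using 1
  rw [div_div]

theorem hasDerivAt_div_log {t : ℝ} (ht : 0 ≤ t) :
    HasDerivAt (fun t => t / Real.log (Real.exp 1 + t)) (divLogDeriv t) t := by
  have h := one_le_log_exp_one_add ht
  have h0 : Real.log (Real.exp 1 + t) ≠ 0 := by positivity
  refine ((hasDerivAt_id t).div (hasDerivAt_log_exp_one_add ht) h0).congr_deriv ?_
  have : Real.exp 1 + t ≠ 0 := by positivity
  simp only [divLogDeriv, id]
  field_simp

theorem divLogDeriv_le {t : ℝ} (ht : 0 ≤ t) : divLogDeriv t ≤ 1 / Real.log (Real.exp 1 + t) :=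
  sub_le_self _ (by positivity)

/-- With `u = log (e + t)` the derivative is `(u - t / (e + t)) / u ^ 2`, and `t / (e + t)` is at
most both `1` and `u - 1`, hence at most their average `u / 2`. -/
theorem le_two_mul_divLogDeriv {t : ℝ} (ht : 0 ≤ t) :
    1 / Real.log (Real.exp 1 + t) ≤ 2 * divLogDeriv t := by
  have h := one_le_log_exp_one_add ht
  set u := Real.log (Real.exp 1 + t) with hu
  have hs : 0 < Real.exp 1 + t := by positivity
  have hexp : Real.exp u = Real.exp 1 + t := Real.exp_log hs
  have h1 : t / (Real.exp 1 + t) ≤ 1 := by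
    rw [div_le_one hs]
    linarith [Real.exp_pos 1]
  have h2 : t / (Real.exp 1 + t) ≤ u - 1 := by
    have h3 : t / (Real.exp 1 + t) = 1 - Real.exp (1 - u) := by
      rw [Real.exp_sub, hexp]
      field_simp
      ring
    have := Real.add_one_le_exp (1 - u)
    linarith
  have h4 : t / (Real.exp 1 + t) ≤ u / 2 := by
    linarith
  have h5 : divLogDeriv t = (u - t / (Real.exp 1 + t)) / u ^ 2 := by
    rw [divLogDeriv, ← hu]
    field_simp
  rw [h5, ← mul_div_assoc, div_le_div_iff₀ (by positivity) (by positivity)]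
  nlinarith

theorem divLogDeriv_nonneg {t : ℝ} (ht : 0 ≤ t) : 0 ≤ divLogDeriv t := by
  have h := one_le_log_exp_one_add ht
  have : 0 ≤ 1 / Real.log (Real.exp 1 + t) := by positivity
  linarith [le_two_mul_divLogDeriv ht]

/-- The layer cake formula for a function `H` on `[0, ∞)` given with a continuous derivative. -/
theorem lintegral_comp_eq_lintegral_meas_lt_mul_deriv {α : Type*} [MeasurableSpace α]
    (μ : Measure α) {F : α → ℝ} (hF0 : ∀ x, 0 ≤ F x) (hF : AEMeasurable F μ) {H h : ℝ → ℝ}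
    (hH0 : H 0 = 0) (hH : ∀ t, 0 ≤ t → HasDerivAt H (h t) t) (hh : ContinuousOn h (Ici 0))
    (hh0 : ∀ t, 0 ≤ t → 0 ≤ h t) :
    ∫⁻ x, ENNReal.ofReal (H (F x)) ∂μ =
      ∫⁻ t in Ioi 0, μ {x | t < F x} * ENNReal.ofReal (h t) := by
  have hint : ∀ t, 0 ≤ t → IntervalIntegrable h volume 0 t := fun t ht =>
    (hh.mono (by rw [uIcc_of_le ht]; exact Icc_subset_Ici_self)).intervalIntegrable
  rw [← lintegral_comp_eq_lintegral_meas_lt_mul μ (ae_of_all _ hF0) hF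
    (fun t ht => hint t ht.le)
    ((ae_restrict_iff' measurableSet_Ioi).2 (ae_of_all _ fun t ht => hh0 t (le_of_lt ht)))]
  congr 1
  ext x
  rw [intervalIntegral.integral_eq_sub_of_hasDerivAt (f := H) _ (hint _ (hF0 x)), hH0, sub_zero]
  intro t ht
  rw [uIcc_of_le (hF0 x)] at ht
  exact hH t ht.1

theorem lintegral_log_log_eq {α : Type*} [MeasurableSpace α] (μ : Measure α) {F : α → ℝ}
    (hF0 : ∀ x, 0 ≤ F x) (hF : AEMeasurable F μ) :
    ∫⁻ x, ENNReal.ofReal (Real.log (Real.log (Real.exp 1 + F x))) ∂μ =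
      ∫⁻ t in Ioi 0, μ {x | t < F x} *
        ENNReal.ofReal (1 / ((Real.exp 1 + t) * Real.log (Real.exp 1 + t))) := by
  refine lintegral_comp_eq_lintegral_meas_lt_mul_deriv μ hF0 hF (by simp)
    (fun t ht => hasDerivAt_log_log ht) ?_ ?_
  · refine continuousOn_const.div ((continuousOn_const.add continuousOn_id).mul
      fun t ht => (hasDerivAt_log_exp_one_add ht).continuousAt.continuousWithinAt) ?_
    intro t ht
    have h := one_le_log_exp_one_add ht
    have ht : 0 ≤ t := ht
    positivity
  · intro t ht
    have h := one_le_log_exp_one_add ht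
    positivity

theorem lintegral_div_log_eq {α : Type*} [MeasurableSpace α] (μ : Measure α) {F : α → ℝ}
    (hF0 : ∀ x, 0 ≤ F x) (hF : AEMeasurable F μ) :
    ∫⁻ x, ENNReal.ofReal (F x / Real.log (Real.exp 1 + F x)) ∂μ =
      ∫⁻ t in Ioi 0, μ {x | t < F x} * ENNReal.ofReal (divLogDeriv t) := by
  refine lintegral_comp_eq_lintegral_meas_lt_mul_deriv μ hF0 hF
    (H := fun t => t / Real.log (Real.exp 1 + t)) (by simp)
    (fun t ht => hasDerivAt_div_log ht) ?_ fun t ht => divLogDeriv_nonneg ht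
  have hlog : ContinuousOn (fun t => Real.log (Real.exp 1 + t)) (Ici 0) := fun t ht =>
    (hasDerivAt_log_exp_one_add ht).continuousAt.continuousWithinAt
  refine (continuousOn_const.div hlog fun t ht => ?_).sub
    (continuousOn_id.div ((continuousOn_const.add continuousOn_id).mul (hlog.pow 2)) fun t ht => ?_)
  all_goals
    have h := one_le_log_exp_one_add ht
    have ht : 0 ≤ t := ht
    positivity

/-! ### Comparison of the integrands. -/

/-- The factor 2 comes from truncating at `t / 2`. For `s ≤ e` the inner logarithm is at most `3`;
for `s ≥ e` it is at most `3 log s`. Either way the excess is at most `log 3 ≤ 2`. -/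
theorem log_log_exp_one_add_two_mul_le {s : ℝ} (hs : 0 ≤ s) :
    Real.log (Real.log (Real.exp 1 + 2 * s)) ≤ Real.posLog (Real.posLog s) + 2 := by
  have he : 2 < Real.exp 1 := by linarith [Real.exp_one_gt_d9]
  have h3 : Real.log 3 ≤ 2 := by linarith [Real.log_le_sub_one_of_pos (show (0 : ℝ) < 3 by norm_num)]
  have hpos : 0 < Real.log (Real.exp 1 + 2 * s) :=
    zero_lt_one.trans_le (one_le_log_exp_one_add (by positivity))
  rcases le_total s (Real.exp 1) with h | h
  · have h1 : Real.log (Real.exp 1 + 2 * s) ≤ 3 := by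
      rw [Real.log_le_iff_le_exp (by positivity)]
      have : Real.exp 3 = Real.exp 1 * Real.exp 1 * Real.exp 1 := by
        rw [← Real.exp_add, ← Real.exp_add]
        norm_num
      nlinarith
    have h2 := Real.log_le_log hpos h1
    have h4 : 0 ≤ Real.posLog (Real.posLog s) := Real.posLog_nonneg
    linarith
  · have hs0 : 0 < s := by linarith
    have hl : 1 ≤ Real.log s := by rwa [Real.le_log_iff_exp_le hs0]
    have h1 : Real.log (Real.exp 1 + 2 * s) ≤ 3 * Real.log s := by
      have := Real.log_le_log (by positivity) (show Real.exp 1 + 2 * s ≤ 3 * s by linarith)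
      rw [Real.log_mul (by norm_num) hs0.ne'] at this
      linarith
    have h2 := Real.log_le_log hpos h1
    rw [Real.log_mul (by norm_num) (by positivity)] at h2
    have h4 : Real.posLog s = Real.log s := Real.posLog_eq_log (by rw [abs_of_pos hs0]; linarith)
    have h5 : Real.log (Real.log s) ≤ Real.posLog (Real.log s) := le_max_right _ _
    rw [h4]
    linarith

theorem posLog_posLog_le {s : ℝ} (hs : 0 ≤ s) :
    Real.posLog (Real.posLog s) ≤ Real.log (Real.log (Real.exp 1 + s)) := by
  have h := one_le_log_exp_one_add hs
  have h1 : Real.posLog s ≤ Real.log (Real.exp 1 + s) := by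
    refine max_le (by linarith) ?_
    rcases hs.eq_or_lt with rfl | h0
    · rw [Real.log_zero]
      linarith
    · exact Real.log_le_log h0 (by linarith [Real.exp_pos 1])
  have h2 : 0 ≤ Real.posLog s := Real.posLog_nonneg
  refine max_le (Real.log_nonneg h) ?_
  rcases h2.eq_or_lt with h0 | h0
  · rw [← h0, Real.log_zero]
    exact Real.log_nonneg h
  · exact Real.log_le_log h0 h1

theorem Psi_le_div_log (x : EuclideanSpace ℝ (Fin d)) {t : ℝ} (ht : 0 ≤ t) :
    Psi x t ≤ t / Real.log (Real.exp 1 + t) := by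
  have h := one_le_log_exp_one_add ht
  have h' := one_le_log_exp_one_add (norm_nonneg x)
  unfold Psi
  gcongr
  linarith

theorem div_log_le_Psi (x : EuclideanSpace ℝ (Fin d)) {t : ℝ} (ht : 0 ≤ t) :
    t / Real.log (Real.exp 1 + t) ≤ (1 + Real.log (Real.exp 1 + ‖x‖)) * Psi x t := by
  have h := one_le_log_exp_one_add ht
  have h' := one_le_log_exp_one_add (norm_nonneg x)
  unfold Psi
  rw [← mul_div_assoc, div_le_div_iff₀ (by positivity) (by positivity)]
  have : Real.log (Real.exp 1 + t) + Real.log (Real.exp 1 + ‖x‖) ≤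
      (1 + Real.log (Real.exp 1 + ‖x‖)) * Real.log (Real.exp 1 + t) := by nlinarith
  calc _ ≤ t * ((1 + Real.log (Real.exp 1 + ‖x‖)) * Real.log (Real.exp 1 + t)) := by gcongr
    _ = _ := by ring

/-- Absorbs the factor `3 ^ d` of the reverse weak type inequality. -/
theorem div_log_mul_le {a t : ℝ} (ha : 1 ≤ a) (ht : 0 ≤ t) :
    a * t / Real.log (Real.exp 1 + a * t) ≤ a * (t / Real.log (Real.exp 1 + t)) := by
  have h := one_le_log_exp_one_add ht
  rw [← mul_div_assoc]
  gcongr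
  nlinarith

/-! ### Integration against `|f| dx` and finiteness of `Mf`. -/

theorem absMeasure_absolutelyContinuous (f : EuclideanSpace ℝ (Fin d) → ℂ) :
    absMeasure f ≪ volume :=
  withDensity_absolutelyContinuous _ _

theorem lintegral_absMeasure {f : EuclideanSpace ℝ (Fin d) → ℂ} (hf : AEMeasurable f volume)
    {H : ℝ → ℝ} (hH : Measurable H) :
    ∫⁻ y, ENNReal.ofReal (H ‖f y‖) ∂absMeasure f = ∫⁻ y, ENNReal.ofReal (‖f y‖ * H ‖f y‖) := by
  rw [absMeasure, lintegral_withDensity_eq_lintegral_mul₀ hf.enorm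
    (g := fun y => ENNReal.ofReal (H ‖f y‖)) (hH.comp_aemeasurable hf.norm).ennreal_ofReal]
  congr 1
  ext y
  rw [Pi.mul_apply, ENNReal.ofReal_mul (norm_nonneg _), ofReal_norm]

theorem setLIntegral_eq_lintegral_of_eqOn_zero {α : Type*} [MeasurableSpace α] {μ : Measure α}
    {s : Set α} (hs : MeasurableSet s) {g : α → ℝ≥0∞} (hg : ∀ x ∉ s, g x = 0) :
    ∫⁻ x in s, g x ∂μ = ∫⁻ x, g x ∂μ := by
  rw [← lintegral_add_compl (μ := μ) g hs, setLIntegral_congr_fun hs.compl (g := 0) fun x hx => hg x hx]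
  simp

theorem integrable_iff_absMeasure_ne_top {f : EuclideanSpace ℝ (Fin d) → ℂ}
    (hf : AEMeasurable f volume) : Integrable f ↔ absMeasure f univ ≠ ∞ := by
  rw [absMeasure_apply, setLIntegral_univ, Integrable, hasFiniteIntegral_iff_enorm, lt_top_iff_ne_top]
  exact and_iff_right hf.aestronglyMeasurable

theorem ae_hlMaximal_lt_top (hd : 1 ≤ d) {f : EuclideanSpace ℝ (Fin d) → ℂ}
    (hf : AEMeasurable f volume) (hfin : absMeasure f univ ≠ ∞) :
    ∀ᵐ x, hlMaximal f x < ∞ := by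
  rw [ae_iff]
  by_contra h
  obtain ⟨n, hn⟩ := ENNReal.exists_nat_mul_gt h
    (show 2 * 5 ^ d * absMeasure f univ ≠ ∞ by finiteness)
  refine hn.not_ge ?_
  -- The height `n + 1` keeps the level positive when `n = 0`.
  calc (n : ℝ≥0∞) * volume {x | ¬ hlMaximal f x < ∞}
      ≤ ENNReal.ofReal (n + 1) * volume {x | ENNReal.ofReal (n + 1) < hlMaximal f x} := by
        gcongr with x
        · rw [← ENNReal.ofReal_natCast]
          exact ENNReal.ofReal_le_ofReal (by linarith)
        · intro hx
          exact ENNReal.ofReal_lt_top.trans_le (not_lt.1 hx)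
    _ ≤ 2 * 5 ^ d * absMeasure f {y | (n : ℝ) + 1 < 2 * ‖f y‖} :=
        mul_volume_lt_hlMaximal_le hd hf hfin (by positivity)
    _ ≤ 2 * 5 ^ d * absMeasure f univ := by
        gcongr
        exact subset_univ _

/-! ### Transfer between the two integrals. -/

theorem lintegral_log_log_lt_top {f : EuclideanSpace ℝ (Fin d) → ℂ}
    {B : Set (EuclideanSpace ℝ (Fin d))} (hB : MeasurableSet B) (hf : AEMeasurable f volume)
    (hsupp : Function.support f ⊆ B) (hfin : absMeasure f univ ≠ ∞)
    (hL : ∫⁻ x in B, ENNReal.ofReal (‖f x‖ * Real.posLog (Real.posLog ‖f x‖)) < ∞) :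
    ∫⁻ y, ENNReal.ofReal (Real.log (Real.log (Real.exp 1 + 2 * ‖f y‖))) ∂absMeasure f < ∞ := by
  have h0 : ∀ x ∉ B, f x = 0 := fun x hx => Function.notMem_support.1 fun h => hx (hsupp h)
  rw [setLIntegral_eq_lintegral_of_eqOn_zero hB fun x hx => by simp [h0 x hx]] at hL
  rw [lintegral_absMeasure hf (H := fun s => Real.log (Real.log (Real.exp 1 + 2 * s)))
    (by fun_prop)]
  calc ∫⁻ y, ENNReal.ofReal (‖f y‖ * Real.log (Real.log (Real.exp 1 + 2 * ‖f y‖)))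
      ≤ ∫⁻ y, (ENNReal.ofReal (‖f y‖ * Real.posLog (Real.posLog ‖f y‖)) + 2 * ‖f y‖ₑ) := by
        refine lintegral_mono fun y => ?_
        rw [← ofReal_norm, ← ENNReal.ofReal_ofNat, ← ENNReal.ofReal_mul (by norm_num),
          ← ENNReal.ofReal_add (mul_nonneg (norm_nonneg _) Real.posLog_nonneg) (by positivity)]
        refine ENNReal.ofReal_le_ofReal ?_
        have := mul_le_mul_of_nonneg_left (log_log_exp_one_add_two_mul_le (norm_nonneg (f y)))
          (norm_nonneg (f y))
        linarith
    _ = (∫⁻ y, ENNReal.ofReal (‖f y‖ * Real.posLog (Real.posLog ‖f y‖))) +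
          2 * absMeasure f univ := by
        rw [lintegral_add_right' _ (hf.enorm.const_mul 2), lintegral_const_mul'' _ hf.enorm,
          absMeasure_apply, setLIntegral_univ]
    _ < ∞ := by finiteness

theorem lintegral_div_log_hlMaximal_lt_top (hd : 1 ≤ d) {f : EuclideanSpace ℝ (Fin d) → ℂ}
    {B : Set (EuclideanSpace ℝ (Fin d))} (hB : volume B ≠ ∞) (hf : AEMeasurable f volume)
    (hfin : absMeasure f univ ≠ ∞)
    (hL : ∫⁻ y, ENNReal.ofReal (Real.log (Real.log (Real.exp 1 + 2 * ‖f y‖))) ∂absMeasure f < ∞) :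
    ∫⁻ x in B, ENNReal.ofReal
      ((hlMaximal f x).toReal / Real.log (Real.exp 1 + (hlMaximal f x).toReal)) < ∞ := by
  rw [lintegral_div_log_eq _ (fun _ => ENNReal.toReal_nonneg)
    (measurable_hlMaximal f).ennreal_toReal.aemeasurable]
  rw [lintegral_log_log_eq _ (fun y => by positivity)
    ((hf.norm.const_mul 2).mono_ac (absMeasure_absolutelyContinuous f))] at hL
  set g : ℝ → ℝ := fun t => 1 / ((Real.exp 1 + t) * Real.log (Real.exp 1 + t))
  have hbound : ∀ t ∈ Ioi (0 : ℝ),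
      volume.restrict B {x | t < (hlMaximal f x).toReal} * ENNReal.ofReal (divLogDeriv t) ≤
        (Ioc 0 (Real.exp 1)).indicator (fun _ => volume B) t +
          4 * 5 ^ d * (absMeasure f {y | t < 2 * ‖f y‖} * ENNReal.ofReal (g t)) := by
    intro t ht
    have ht : 0 < t := ht
    have hlog := one_le_log_exp_one_add ht.le
    have hd1 := divLogDeriv_le ht.le
    rcases le_or_gt t (Real.exp 1) with hte | hte
    · refine le_add_right ?_
      rw [indicator_of_mem (mem_Ioc.2 ⟨ht, hte⟩), ← mul_one (volume B)]
      refine mul_le_mul' ?_ ?_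
      · exact (measure_mono (subset_univ _)).trans_eq (Measure.restrict_apply_univ B)
      · rw [ENNReal.ofReal_le_one]
        exact hd1.trans ((div_le_one (by positivity)).2 hlog)
    · refine le_add_left ?_
      -- Above `e` one has `e + t ≤ 2 * t`; this is why the range is split there.
      have h1 : divLogDeriv t ≤ t * (2 * g t) := by
        refine hd1.trans ?_
        have : t * (2 * g t) = (2 * t / (Real.exp 1 + t)) * (1 / Real.log (Real.exp 1 + t)) := by
          simp only [g]
          field_simp
        rw [this]
        refine le_mul_of_one_le_left (by positivity) ?_
        rw [one_le_div (by positivity)]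
        linarith
      calc volume.restrict B {x | t < (hlMaximal f x).toReal} * ENNReal.ofReal (divLogDeriv t)
          ≤ volume {x | ENNReal.ofReal t < hlMaximal f x} *
              (ENNReal.ofReal t * (2 * ENNReal.ofReal (g t))) := by
            refine mul_le_mul' ?_ ?_
            · refine (Measure.restrict_apply_le _ _).trans (measure_mono fun x hx => ?_)
              have hx : t < (hlMaximal f x).toReal := hx
              exact ((ENNReal.ofReal_lt_ofReal_iff (ht.trans hx)).2 hx).trans_le
                ENNReal.ofReal_toReal_le
            · rw [← ENNReal.ofReal_ofNat, ← ENNReal.ofReal_mul (by norm_num),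
                ← ENNReal.ofReal_mul ht.le]
              exact ENNReal.ofReal_le_ofReal h1
        _ = 2 * (ENNReal.ofReal t * volume {x | ENNReal.ofReal t < hlMaximal f x}) *
              ENNReal.ofReal (g t) := by ring
        _ ≤ 2 * (2 * 5 ^ d * absMeasure f {y | t < 2 * ‖f y‖}) * ENNReal.ofReal (g t) := by
            refine mul_le_mul_left (mul_le_mul_right ?_ _) _
            exact mul_volume_lt_hlMaximal_le hd hf hfin ht
        _ = _ := by ring
  refine (setLIntegral_mono' measurableSet_Ioi hbound).trans_lt ?_
  rw [lintegral_add_left (measurable_const.indicator measurableSet_Ioc),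
    lintegral_const_mul' _ _ (by finiteness)]
  refine ENNReal.add_lt_top.2 ⟨?_, ENNReal.mul_lt_top (by finiteness) hL⟩
  refine (setLIntegral_le_lintegral _ _).trans_lt ?_
  rw [lintegral_indicator measurableSet_Ioc, setLIntegral_const, Real.volume_Ioc]
  finiteness

theorem lintegral_log_log_absMeasure_lt_top {f : EuclideanSpace ℝ (Fin d) → ℂ}
    (hf : AEMeasurable f volume) {x₀ : EuclideanSpace ℝ (Fin d)} {r₀ : ℝ} (hr₀ : 0 < r₀)
    (hsupp : Function.support f ⊆ closedBall x₀ r₀) (hfin : absMeasure f univ ≠ ∞)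
    (hM : ∀ᵐ x ∂(volume.restrict (closedBall x₀ r₀)), hlMaximal f x < ∞)
    (hL : ∫⁻ x in closedBall x₀ r₀, ENNReal.ofReal
      ((hlMaximal f x).toReal / Real.log (Real.exp 1 + (hlMaximal f x).toReal)) < ∞) :
    ∫⁻ y, ENNReal.ofReal (Real.log (Real.log (Real.exp 1 + ‖f y‖))) ∂absMeasure f < ∞ := by
  set B := closedBall x₀ r₀
  set F : EuclideanSpace ℝ (Fin d) → ℝ := fun x => 3 ^ d * (hlMaximal f x).toReal
  have hFm : AEMeasurable F (volume.restrict B) :=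
    ((measurable_hlMaximal f).ennreal_toReal.const_mul _).aemeasurable
  have hLF : ∫⁻ x in B, ENNReal.ofReal (F x / Real.log (Real.exp 1 + F x)) < ∞ := by
    refine lt_of_le_of_lt (lintegral_mono fun x => ?_) (show ∫⁻ x in B, 3 ^ d * ENNReal.ofReal
      ((hlMaximal f x).toReal / Real.log (Real.exp 1 + (hlMaximal f x).toReal)) < ∞ from ?_)
    · refine (ENNReal.ofReal_le_ofReal
        (div_log_mul_le (one_le_pow₀ (by norm_num)) ENNReal.toReal_nonneg)).trans ?_
      rw [ENNReal.ofReal_mul (by positivity), ENNReal.ofReal_pow (by norm_num),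
        ENNReal.ofReal_ofNat]
    · rw [lintegral_const_mul' _ _ (by finiteness)]
      exact ENNReal.mul_lt_top (by finiteness) hL
  rw [lintegral_div_log_eq _ (fun _ => by positivity) hFm] at hLF
  rw [lintegral_log_log_eq _ (fun y => norm_nonneg _)
    (hf.norm.mono_ac (absMeasure_absolutelyContinuous f))]
  set V := volume (closedBall (0 : EuclideanSpace ℝ (Fin d)) (2 * r₀)) with hV
  have hV0 : V ≠ 0 := (measure_closedBall_pos _ _ (by positivity)).ne'
  have hVt : V ≠ ∞ := measure_closedBall_lt_top.ne
  -- The threshold beyond which `absMeasure_lt_norm_le` applies.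
  set t₀ := (absMeasure f univ / V).toReal with ht₀
  have hbound : ∀ t ∈ Ioi (0 : ℝ),
      absMeasure f {y | t < ‖f y‖} *
          ENNReal.ofReal (1 / ((Real.exp 1 + t) * Real.log (Real.exp 1 + t))) ≤
        (Ioc 0 t₀).indicator (fun _ => absMeasure f univ) t +
          2 * 20 ^ d * (volume.restrict B {x | t < F x} * ENNReal.ofReal (divLogDeriv t)) := by
    intro t ht
    have ht : 0 < t := ht
    have hlog := one_le_log_exp_one_add ht.le
    have hd2 := le_two_mul_divLogDeriv ht.le
    rcases le_or_gt t t₀ with hte | hte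
    · refine le_add_right ?_
      rw [indicator_of_mem (mem_Ioc.2 ⟨ht, hte⟩), ← mul_one (absMeasure f univ)]
      gcongr
      · exact subset_univ _
      · rw [ENNReal.ofReal_le_one, div_le_one (by positivity)]
        have : 1 ≤ Real.exp 1 := Real.one_le_exp (by norm_num)
        nlinarith
    · refine le_add_left ?_
      have hlarge : absMeasure f univ ≤ ENNReal.ofReal t * V := by
        rw [← ENNReal.div_le_iff hV0 hVt, ← ENNReal.ofReal_toReal (ENNReal.div_ne_top hfin hV0)]
        exact ENNReal.ofReal_le_ofReal hte.le
      have h1 : t * (1 / ((Real.exp 1 + t) * Real.log (Real.exp 1 + t))) ≤ 2 * divLogDeriv t := by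
        refine le_trans ?_ hd2
        have : t * (1 / ((Real.exp 1 + t) * Real.log (Real.exp 1 + t))) =
            (t / (Real.exp 1 + t)) * (1 / Real.log (Real.exp 1 + t)) := by
          field_simp
        rw [this]
        refine mul_le_of_le_one_left (by positivity) ?_
        rw [div_le_one (by positivity)]
        linarith [Real.exp_pos 1]
      have h2 : volume ({x | ENNReal.ofReal t < 3 ^ d * hlMaximal f x} ∩ B) ≤
          volume.restrict B {x | t < F x} := by
        rw [← Measure.restrict_apply' measurableSet_closedBall]
        -- Since `toReal` sends `∞` to `0`, points with `Mf = ∞` would be lost; by `hM` they form a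
        -- null set.
        refine measure_mono_ae ?_
        filter_upwards [hM] with x hx hxt
        have hxt : ENNReal.ofReal t < 3 ^ d * hlMaximal f x := hxt
        change t < F x
        have := (ENNReal.ofReal_lt_iff_lt_toReal ht.le
          (ENNReal.mul_ne_top (by finiteness) hx.ne)).1 hxt
        simpa [F] using this
      calc absMeasure f {y | t < ‖f y‖} *
            ENNReal.ofReal (1 / ((Real.exp 1 + t) * Real.log (Real.exp 1 + t)))
          ≤ (20 ^ d * (ENNReal.ofReal t * volume.restrict B {x | t < F x})) *
              ENNReal.ofReal (1 / ((Real.exp 1 + t) * Real.log (Real.exp 1 + t))) := by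
            gcongr
            exact (absMeasure_lt_norm_le hf hr₀ hsupp hfin ht hlarge).trans (by gcongr)
        _ = 20 ^ d * volume.restrict B {x | t < F x} *
              ENNReal.ofReal (t * (1 / ((Real.exp 1 + t) * Real.log (Real.exp 1 + t)))) := by
            rw [ENNReal.ofReal_mul ht.le]
            ring
        _ ≤ 20 ^ d * volume.restrict B {x | t < F x} * ENNReal.ofReal (2 * divLogDeriv t) := by
            gcongr
        _ = _ := by
            rw [ENNReal.ofReal_mul (by norm_num), ENNReal.ofReal_ofNat]
            ring
  refine (setLIntegral_mono' measurableSet_Ioi hbound).trans_lt ?_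
  rw [lintegral_add_left (measurable_const.indicator measurableSet_Ioc),
    lintegral_const_mul' _ _ (by finiteness)]
  refine ENNReal.add_lt_top.2 ⟨?_, ENNReal.mul_lt_top (by finiteness) hLF⟩
  refine (setLIntegral_le_lintegral _ _).trans_lt ?_
  rw [lintegral_indicator measurableSet_Ioc, setLIntegral_const, Real.volume_Ioc]
  finiteness

/-- One point `x` of `B` with `Mf(x) < ∞` suffices: a single ball about `x` contains `B`, so its
mean bounds `‖f‖₁`. -/
theorem absMeasure_univ_ne_top {f : EuclideanSpace ℝ (Fin d) → ℂ}
    {x₀ : EuclideanSpace ℝ (Fin d)} {r₀ : ℝ} (hr₀ : 0 < r₀)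
    (hsupp : Function.support f ⊆ closedBall x₀ r₀)
    (hM : ∀ᵐ x ∂(volume.restrict (closedBall x₀ r₀)), hlMaximal f x < ∞) :
    absMeasure f univ ≠ ∞ := by
  have hne : (ae (volume.restrict (closedBall x₀ r₀))).NeBot := by
    rw [ae_restrict_neBot]
    exact (measure_closedBall_pos _ _ hr₀).ne'
  obtain ⟨x, hx, hxB⟩ := (hM.and (ae_restrict_mem measurableSet_closedBall)).exists
  have h0 : absMeasure f univ = absMeasure f (closedBall x₀ r₀) := by
    rw [absMeasure_apply, absMeasure_apply, setLIntegral_univ]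
    refine (setLIntegral_eq_lintegral_of_eqOn_zero measurableSet_closedBall fun y hy => ?_).symm
    rw [Function.notMem_support.1 fun h => hy (hsupp h), enorm_zero]
  have hsub : closedBall x₀ r₀ ⊆ ball x (2 * r₀ + 1) := by
    intro y hy
    have := dist_triangle_right y x x₀
    rw [mem_closedBall] at hxB hy
    rw [mem_ball]
    linarith
  rw [h0]
  intro htop
  refine hx.not_ge ?_
  rw [hlMaximal_eq_iSup]
  refine le_trans ?_ (le_iSup₂ (2 * r₀ + 1) (by positivity))
  have htop' : absMeasure f (ball x (2 * r₀ + 1)) = ∞ :=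
    top_unique (htop.ge.trans (measure_mono hsub))
  rw [htop', ENNReal.top_div_of_ne_top measure_ball_lt_top.ne]

end

theorem mainTheorem1 {d : ℕ} (hd : 1 ≤ d) (x₀ : EuclideanSpace ℝ (Fin d)) (r₀ : ℝ) (hr₀ : 0 < r₀)
    (f : EuclideanSpace ℝ (Fin d) → ℂ) (hf : AEMeasurable f volume)
    (hsupp : Function.support f ⊆ closedBall x₀ r₀) :
    MemLPsi (closedBall x₀ r₀) (hlMaximal f) ↔ MemLLogLogL (closedBall x₀ r₀) f := by
  constructor
  · rintro ⟨-, hM, hL⟩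
    have hfin := absMeasure_univ_ne_top hr₀ hsupp hM
    refine ⟨((integrable_iff_absMeasure_ne_top hf).2 hfin).locallyIntegrable, hsupp, ?_⟩
    have hL' : ∫⁻ x in closedBall x₀ r₀, ENNReal.ofReal
        ((hlMaximal f x).toReal / Real.log (Real.exp 1 + (hlMaximal f x).toReal)) < ∞ := by
      -- `K` bounds the factor of `div_log_le_Psi` uniformly on the ball, where `‖x‖ ≤ ‖x₀‖ + r₀`.
      set K := 1 + Real.log (Real.exp 1 + (‖x₀‖ + r₀)) with hK
      have hK0 : 0 ≤ K := by
        have := one_le_log_exp_one_add (add_nonneg (norm_nonneg x₀) hr₀.le)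
        positivity
      have hb : ∀ x ∈ closedBall x₀ r₀, ENNReal.ofReal
          ((hlMaximal f x).toReal / Real.log (Real.exp 1 + (hlMaximal f x).toReal)) ≤
          ENNReal.ofReal K * ENNReal.ofReal (Psi x (hlMaximal f x).toReal) := by
        intro x hx
        rw [← ENNReal.ofReal_mul hK0]
        refine ENNReal.ofReal_le_ofReal ((div_log_le_Psi x ENNReal.toReal_nonneg).trans ?_)
        have h1 := one_le_log_exp_one_add (norm_nonneg x)
        have h2 := one_le_log_exp_one_add (t := (hlMaximal f x).toReal) ENNReal.toReal_nonneg
        have h3 : ‖x‖ ≤ ‖x₀‖ + r₀ := by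
          have := norm_le_norm_add_norm_sub' x x₀
          rw [mem_closedBall, dist_eq_norm] at hx
          linarith
        have h4 : 0 ≤ Psi x (hlMaximal f x).toReal := by
          unfold Psi
          positivity
        rw [hK]
        gcongr
      refine (setLIntegral_mono' measurableSet_closedBall hb).trans_lt ?_
      rw [lintegral_const_mul' _ _ ENNReal.ofReal_ne_top]
      exact ENNReal.mul_lt_top ENNReal.ofReal_lt_top hL
    have h := lintegral_log_log_absMeasure_lt_top hf hr₀ hsupp hfin hM hL'
    rw [lintegral_absMeasure hf (H := fun s => Real.log (Real.log (Real.exp 1 + s)))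
      (by fun_prop)] at h
    refine ((setLIntegral_le_lintegral _ _).trans (lintegral_mono fun y => ?_)).trans_lt h
    exact ENNReal.ofReal_le_ofReal
      (mul_le_mul_of_nonneg_left (posLog_posLog_le (norm_nonneg _)) (norm_nonneg _))
  · rintro ⟨hloc, -, hL⟩
    have hint : Integrable f := (integrableOn_iff_integrable_of_support_subset hsupp).1
      (hloc.integrableOn_isCompact (isCompact_closedBall x₀ r₀))
    have hfin := (integrable_iff_absMeasure_ne_top hf).1 hint
    refine ⟨(measurable_hlMaximal f).aemeasurable,
      ae_restrict_of_ae (ae_hlMaximal_lt_top hd hf hfin), ?_⟩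
    refine lt_of_le_of_lt (lintegral_mono fun x => ENNReal.ofReal_le_ofReal
      (Psi_le_div_log x ENNReal.toReal_nonneg)) ?_
    exact lintegral_div_log_hlMaximal_lt_top hd measure_closedBall_lt_top.ne hf hfin
      (lintegral_log_log_lt_top measurableSet_closedBall hf hsupp hfin hL)
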